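/- Let $\mathbb K\in\{\mathbb R,\mathbb C\}$. A \emph{Fréchet algebra} $(\mathcal A,(p_\ell)_{\ell\in\mathbb N})$ is an associative (not necessarily unital or commutative) $\mathbb K$-algebra that is complete and Hausdorff for the topology generated by an increasing sequence $(p_\ell)$ of submultiplicative seminorms. Let $\mathcal A^*$ be its topological dual with the strong topology (uniform convergence on bounded subsets of $\mathcal A$), and $\mathcal A^{**}$ the topological dual of $\mathcal A^*$. For $a,b\in\mathcal A$, $f\in\mathcal A^*$, $F,G\in\mathcal A^{**}$ put $$(f\cdot a)(b)=f(ab),\quad (a\cdot f)(b)=f(ba),\quad (F\cdot f)(a)=F(f\cdot a),\quad (f\cdot F)(a)=F(a\cdot f),$$ and define the two Arens products by $$(F\,\square\, G)(f)=F(G\cdot f),\qquad (F\,\Diamond\, G)(f)=G(f\cdot F).$$ $\mathcal A$ is called \emph{Arens regular} if $F\,\square\, G=F\,\Diamond\, G$ for all $F,G\in\mathcal A^{**}$. Let $(\mathcal A_n,(p^n_\ell)_{\ell\in\mathbb N})_{n\in\mathbb N}$ be a sequence of Fréchet algebras, and let $$\ell^1\text{-}\prod_{n}\mathcal A_n=\Big\{(a_n)\in\prod_n\mathcal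 A_n:\ \sum_{n}p^n_\ell(a_n)<\infty\ \text{ for every }\ell\in\mathbb N\Big\},$$ which is a Fréchet algebra with the pointwise operations and the seminorms $r_\ell((a_n))=\sum_n p^n_\ell(a_n)$. \textbf{Theorem.} $\ell^1\text{-}\prod_n\mathcal A_n$ is Arens regular if and only if every $\mathcal A_n$ is Arens regular. -/

import Mathlib

open Filter Topology

set_option linter.unusedSectionVars false

/-- A Fréchet algebra over `𝕜 = ℝ` or `ℂ`, with a chosen fundamental system of seminorms: an
associative, not necessarily unital or commutative, `𝕜`-algebra `A` which is Hausdorff and complete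
for the topology generated by an increasing sequence of submultiplicative seminorms. -/
class FrechetAlgebra (𝕜 : Type*) (A : Type*) [RCLike 𝕜] [NonUnitalRing A] [Module 𝕜 A]
    [IsScalarTower 𝕜 A A] [SMulCommClass 𝕜 A A] [UniformSpace A] [IsUniformAddGroup A] where
  /-- The seminorm `p_ℓ`. -/
  seminorm : ℕ → Seminorm 𝕜 A
  withSeminorms : WithSeminorms seminorm
  monotone : Monotone seminorm
  mul_le : ∀ (ℓ : ℕ) (a b : A), seminorm ℓ (a * b) ≤ seminorm ℓ a * seminorm ℓ b
  t2 : T2Space A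
  complete : CompleteSpace A

namespace FrechetAlgebra

section Arens

variable {𝕜 A : Type*} [RCLike 𝕜] [NonUnitalRing A] [Module 𝕜 A]
  [IsScalarTower 𝕜 A A] [SMulCommClass 𝕜 A A] [UniformSpace A] [IsUniformAddGroup A]
  [FrechetAlgebra 𝕜 A]

theorem continuous_mul (𝕜 A : Type*) [RCLike 𝕜] [NonUnitalRing A] [Module 𝕜 A]
    [IsScalarTower 𝕜 A A] [SMulCommClass 𝕜 A A] [UniformSpace A] [IsUniformAddGroup A]
    [FrechetAlgebra 𝕜 A] :
    Continuous fun x : A × A => x.1 * x.2 := by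
  have hw := withSeminorms (𝕜 := 𝕜) (A := A)
  rw [continuous_iff_continuousAt]
  rintro ⟨a, b⟩
  rw [ContinuousAt, hw.tendsto_nhds]
  intro ℓ ε hε
  have hc : Continuous (seminorm (𝕜 := 𝕜) (A := A) ℓ) := hw.continuous_seminorm ℓ
  have ht : Tendsto (fun x : A × A =>
      seminorm (𝕜 := 𝕜) ℓ (x.1 - a) * seminorm (𝕜 := 𝕜) ℓ x.2 +
      seminorm (𝕜 := 𝕜) ℓ a * seminorm (𝕜 := 𝕜) ℓ (x.2 - b)) (𝓝 (a, b)) (𝓝 0) := by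
    have : Continuous (fun x : A × A =>
      seminorm (𝕜 := 𝕜) ℓ (x.1 - a) * seminorm (𝕜 := 𝕜) ℓ x.2 +
      seminorm (𝕜 := 𝕜) ℓ a * seminorm (𝕜 := 𝕜) ℓ (x.2 - b)) := by fun_prop
    have h := this.tendsto (a, b)
    simpa using h
  filter_upwards [ht.eventually_lt_const hε] with x hx
  refine lt_of_le_of_lt ?_ hx
  have : x.1 * x.2 - a * b = (x.1 - a) * x.2 + a * (x.2 - b) := by
    rw [sub_mul, mul_sub]; abel
  rw [this]
  exact (map_add_le_add _ _ _).trans (add_le_add (mul_le _ _ _) (mul_le _ _ _))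

variable (𝕜) in
theorem isVonNBounded_mul {M N : Set A} (hM : Bornology.IsVonNBounded 𝕜 M)
    (hN : Bornology.IsVonNBounded 𝕜 N) :
    Bornology.IsVonNBounded 𝕜 (Set.image2 (fun a b => a * b) M N) := by
  have hw := withSeminorms (𝕜 := 𝕜) (A := A)
  rw [hw.isVonNBounded_iff_seminorm_bounded] at *
  intro ℓ
  obtain ⟨r, hr, hr'⟩ := hM ℓ
  obtain ⟨s, hs, hs'⟩ := hN ℓ
  refine ⟨r * s, mul_pos hr hs, ?_⟩
  rintro _ ⟨a, ha, b, hb, rfl⟩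
  exact (mul_le ℓ a b).trans_lt
    (mul_lt_mul'' (hr' a ha) (hs' b hb) (apply_nonneg _ _) (apply_nonneg _ _))

/-- `f · a`, the functional `b ↦ f (a * b)`. -/
def dualSMulRight (f : StrongDual 𝕜 A) (a : A) : StrongDual 𝕜 A where
  toLinearMap := f.toLinearMap ∘ₗ LinearMap.mulLeft 𝕜 a
  cont := f.continuous.comp ((continuous_mul 𝕜 A).comp (by fun_prop : Continuous fun b => (a, b)))

/-- `a · f`, the functional `b ↦ f (b * a)`. -/
def dualSMulLeft (a : A) (f : StrongDual 𝕜 A) : StrongDual 𝕜 A where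
  toLinearMap := f.toLinearMap ∘ₗ LinearMap.mulRight 𝕜 a
  cont := f.continuous.comp ((continuous_mul 𝕜 A).comp (by fun_prop : Continuous fun b => (b, a)))

@[simp] theorem dualSMulRight_apply (f : StrongDual 𝕜 A) (a b : A) :
    dualSMulRight f a b = f (a * b) := rfl

@[simp] theorem dualSMulLeft_apply (f : StrongDual 𝕜 A) (a b : A) :
    dualSMulLeft a f b = f (b * a) := rfl

/-- The map `a ↦ f · a` from `A` to its strong dual. -/
def rightOrbit (f : StrongDual 𝕜 A) : A →L[𝕜] StrongDual 𝕜 A where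
  toFun a := dualSMulRight f a
  map_add' a b := by ext x; simp [add_mul]
  map_smul' c a := by ext x; simp [smul_mul_assoc]
  cont := by
    have := (withSeminorms (𝕜 := 𝕜) (A := A)).continuousSMul
    exact ContinuousLinearMap.continuous_of_continuous_uncurry
      (B := ({ toFun := fun a => dualSMulRight f a
               map_add' := fun a b => by ext x; simp [add_mul]
               map_smul' := fun c a => by ext x; simp [smul_mul_assoc] } :
                A →ₗ[𝕜] StrongDual 𝕜 A))
      (f.continuous.comp (continuous_mul 𝕜 A))

/-- The map `a ↦ a · f` from `A` to its strong dual. -/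
def leftOrbit (f : StrongDual 𝕜 A) : A →L[𝕜] StrongDual 𝕜 A where
  toFun a := dualSMulLeft a f
  map_add' a b := by ext x; simp [mul_add]
  map_smul' c a := by ext x; simp [mul_smul_comm]
  cont := by
    have := (withSeminorms (𝕜 := 𝕜) (A := A)).continuousSMul
    exact ContinuousLinearMap.continuous_of_continuous_uncurry
      (B := ({ toFun := fun a => dualSMulLeft a f
               map_add' := fun a b => by ext x; simp [mul_add]
               map_smul' := fun c a => by ext x; simp [mul_smul_comm] } :
                A →ₗ[𝕜] StrongDual 𝕜 A))
      (f.continuous.comp ((continuous_mul 𝕜 A).comp continuous_swap))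

theorem continuous_of_orbit (G : StrongDual 𝕜 (StrongDual 𝕜 A))
    (T : StrongDual 𝕜 A →ₗ[𝕜] StrongDual 𝕜 A) (S : StrongDual 𝕜 A → A → StrongDual 𝕜 A)
    (hT : ∀ f a, T f a = G (S f a)) (m : A → A → A)
    (hm : ∀ M N : Set A, Bornology.IsVonNBounded 𝕜 M → Bornology.IsVonNBounded 𝕜 N →
      Bornology.IsVonNBounded 𝕜 (Set.image2 m M N))
    (hS : ∀ f a b, S f a b = f (m a b)) : Continuous T := by
  refine continuous_of_continuousAt_zero T ?_
  rw [ContinuousAt, map_zero,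
    (ContinuousLinearMap.hasBasis_nhds_zero (σ := RingHom.id 𝕜) (E := A) (F := 𝕜)).tendsto_iff
    (ContinuousLinearMap.hasBasis_nhds_zero (σ := RingHom.id 𝕜) (E := A) (F := 𝕜))]
  rintro ⟨M, V⟩ ⟨hM, hV⟩
  have hG : G ⁻¹' V ∈ 𝓝 (0 : StrongDual 𝕜 A) :=
    G.continuous.continuousAt.preimage_mem_nhds (by simpa using hV)
  obtain ⟨⟨N, W⟩, ⟨hN, hW⟩, hNW⟩ := (ContinuousLinearMap.hasBasis_nhds_zero
    (σ := RingHom.id 𝕜) (E := A) (F := 𝕜)).mem_iff.1 hG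
  refine ⟨(Set.image2 m M N, W), ⟨hm M N hM hN, hW⟩, ?_⟩
  intro f hf a ha
  rw [hT]
  refine hNW (fun b hb => ?_)
  rw [hS]
  exact hf _ ⟨a, ha, b, hb, rfl⟩

/-- For `F` in the bidual, the operator `f ↦ F · f` on the strong dual, where `F · f` is the
functional `a ↦ F (f · a)`. -/
def bidualSMulLeft (F : StrongDual 𝕜 (StrongDual 𝕜 A)) : StrongDual 𝕜 A →L[𝕜] StrongDual 𝕜 A where
  toFun f := F.comp (rightOrbit f)
  map_add' f g := by ext a; exact map_add F (dualSMulRight f a) (dualSMulRight g a)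
  map_smul' c f := by ext a; exact map_smul F c (dualSMulRight f a)
  cont := continuous_of_orbit F
    { toFun := fun f => F.comp (rightOrbit f)
      map_add' := fun f g => by ext a; exact map_add F (dualSMulRight f a) (dualSMulRight g a)
      map_smul' := fun c f => by ext a; exact map_smul F c (dualSMulRight f a) }
    dualSMulRight (fun _ _ => rfl) (fun a b => a * b) (fun _ _ hM hN => isVonNBounded_mul 𝕜 hM hN)
    (fun _ _ _ => rfl)

/-- For `F` in the bidual, the operator `f ↦ f · F` on the strong dual, where `f · F` is the
functional `a ↦ F (a · f)`. -/
def bidualSMulRight (F : StrongDual 𝕜 (StrongDual 𝕜 A)) : StrongDual 𝕜 A →L[𝕜] StrongDual 𝕜 A where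
  toFun f := F.comp (leftOrbit f)
  map_add' f g := by ext a; exact map_add F (dualSMulLeft a f) (dualSMulLeft a g)
  map_smul' c f := by ext a; exact map_smul F c (dualSMulLeft a f)
  cont := continuous_of_orbit F
    { toFun := fun f => F.comp (leftOrbit f)
      map_add' := fun f g => by ext a; exact map_add F (dualSMulLeft a f) (dualSMulLeft a g)
      map_smul' := fun c f => by ext a; exact map_smul F c (dualSMulLeft a f) }
    (fun f a => dualSMulLeft a f) (fun _ _ => rfl) (fun a b => b * a)
    (fun M N hM hN => by rw [Set.image2_swap]; exact isVonNBounded_mul 𝕜 hN hM)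
    (fun _ _ _ => rfl)

theorem bidualSMulLeft_apply (F : StrongDual 𝕜 (StrongDual 𝕜 A)) (f : StrongDual 𝕜 A)
    (a : A) : bidualSMulLeft F f a = F (dualSMulRight f a) := rfl

theorem bidualSMulRight_apply (F : StrongDual 𝕜 (StrongDual 𝕜 A)) (f : StrongDual 𝕜 A)
    (a : A) : bidualSMulRight F f a = F (dualSMulLeft a f) := rfl

/-- The first Arens product `F □ G` on the bidual: `(F □ G) f = F (G · f)`. -/
def firstArens (F G : StrongDual 𝕜 (StrongDual 𝕜 A)) : StrongDual 𝕜 (StrongDual 𝕜 A) :=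
  F.comp (bidualSMulLeft G)

/-- The second Arens product `F ◇ G` on the bidual: `(F ◇ G) f = G (f · F)`. -/
def secondArens (F G : StrongDual 𝕜 (StrongDual 𝕜 A)) : StrongDual 𝕜 (StrongDual 𝕜 A) :=
  G.comp (bidualSMulRight F)

variable (𝕜 A) in
/-- `A` is Arens regular if both Arens products coincide on the strong bidual of `A`. -/
def IsArensRegular : Prop :=
  ∀ F G : StrongDual 𝕜 (StrongDual 𝕜 A), firstArens F G = secondArens F G

end Arens

section Ell1

variable (𝕜 : Type*) (A : ℕ → Type*) [RCLike 𝕜] [∀ n, NonUnitalRing (A n)] [∀ n, Module 𝕜 (A n)]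
  [∀ n, IsScalarTower 𝕜 (A n) (A n)] [∀ n, SMulCommClass 𝕜 (A n) (A n)]
  [∀ n, UniformSpace (A n)] [∀ n, IsUniformAddGroup (A n)] [∀ n, FrechetAlgebra 𝕜 (A n)]

/-- The subalgebra of `∏ A n` (with the pointwise product) of all sequences `a` such that
`∑ n, p^n_ℓ (a n) < ∞` for every `ℓ`. -/
def ell1Subalgebra : NonUnitalSubalgebra 𝕜 (∀ n, A n) where
  carrier := {a | ∀ ℓ : ℕ, Summable fun n => seminorm (𝕜 := 𝕜) ℓ (a n)}
  zero_mem' ℓ := by simp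
  add_mem' {a b} ha hb ℓ := Summable.of_nonneg_of_le (fun _ => apply_nonneg _ _)
    (fun _ => map_add_le_add _ _ _) ((ha ℓ).add (hb ℓ))
  smul_mem' c a ha ℓ := by simpa [map_smul_eq_mul] using (ha ℓ).mul_left ‖c‖
  mul_mem' {a b} ha hb ℓ := by
    refine Summable.of_nonneg_of_le (fun _ => apply_nonneg _ _) (fun n => ?_)
      ((ha ℓ).mul_right (∑' n, seminorm (𝕜 := 𝕜) ℓ (b n)))
    exact (mul_le ℓ (a n) (b n)).trans (mul_le_mul_of_nonneg_left
      ((hb ℓ).le_tsum n fun _ _ => apply_nonneg _ _) (apply_nonneg _ _))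

/-- The `ℓ¹`-product of the sequence `A` of Fréchet algebras. It is a type synonym, since its
topology is not the one induced by the product topology. -/
def Ell1Prod : Type _ := ell1Subalgebra 𝕜 A

namespace Ell1Prod

instance : NonUnitalRing (Ell1Prod 𝕜 A) := inferInstanceAs (NonUnitalRing (ell1Subalgebra 𝕜 A))
instance : Module 𝕜 (Ell1Prod 𝕜 A) := inferInstanceAs (Module 𝕜 (ell1Subalgebra 𝕜 A))
instance : IsScalarTower 𝕜 (Ell1Prod 𝕜 A) (Ell1Prod 𝕜 A) :=
  inferInstanceAs (IsScalarTower 𝕜 (ell1Subalgebra 𝕜 A) (ell1Subalgebra 𝕜 A))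
instance : SMulCommClass 𝕜 (Ell1Prod 𝕜 A) (Ell1Prod 𝕜 A) :=
  inferInstanceAs (SMulCommClass 𝕜 (ell1Subalgebra 𝕜 A) (ell1Subalgebra 𝕜 A))

variable {𝕜 A}

/-- The `n`-th coordinate, as a linear map. -/
def coord (n : ℕ) : Ell1Prod 𝕜 A →ₗ[𝕜] A n where
  toFun a := a.1 n
  map_add' _ _ := rfl
  map_smul' _ _ := rfl

theorem coord_mul (n : ℕ) (a b : Ell1Prod 𝕜 A) : coord n (a * b) = coord n a * coord n b := rfl

theorem ext_coord {a b : Ell1Prod 𝕜 A} (h : ∀ n, coord n a = coord n b) : a = b :=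
  Subtype.ext (funext h)

theorem summable (ℓ : ℕ) (a : Ell1Prod 𝕜 A) :
    Summable fun n => seminorm (𝕜 := 𝕜) ℓ (coord n a) := a.2 ℓ

variable (𝕜 A) in
/-- The seminorm `r_ℓ a = ∑ n, p^n_ℓ (a n)` on the `ℓ¹`-product. -/
noncomputable def r (ℓ : ℕ) : Seminorm 𝕜 (Ell1Prod 𝕜 A) :=
  Seminorm.of (fun a => ∑' n, seminorm (𝕜 := 𝕜) ℓ (coord n a))
    (fun a b => by
      rw [← (summable ℓ a).tsum_add (summable ℓ b)]
      refine (summable ℓ (a + b)).tsum_le_tsum (fun n => ?_) ((summable ℓ a).add (summable ℓ b))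
      rw [map_add]
      exact map_add_le_add _ _ _)
    (fun c a => by
      rw [← tsum_mul_left]
      simp only [map_smul, map_smul_eq_mul])

theorem r_apply (ℓ : ℕ) (a : Ell1Prod 𝕜 A) :
    r 𝕜 A ℓ a = ∑' n, seminorm (𝕜 := 𝕜) ℓ (coord n a) := rfl

theorem seminorm_coord_le (ℓ n : ℕ) (a : Ell1Prod 𝕜 A) :
    seminorm (𝕜 := 𝕜) ℓ (coord n a) ≤ r 𝕜 A ℓ a :=
  (summable ℓ a).le_tsum n fun _ _ => apply_nonneg _ _

/-- The uniform structure (and topology) of the `ℓ¹`-product, generated by the seminorms `r_ℓ`. -/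
noncomputable instance : UniformSpace (Ell1Prod 𝕜 A) :=
  ⨅ ℓ, (r 𝕜 A ℓ).toSeminormedAddCommGroup.toUniformSpace

instance : IsUniformAddGroup (Ell1Prod 𝕜 A) :=
  isUniformAddGroup_iInf fun ℓ =>
    @SeminormedAddCommGroup.to_isUniformAddGroup _ (r 𝕜 A ℓ).toSeminormedAddCommGroup

theorem withSeminorms_r : WithSeminorms (r 𝕜 A) :=
  (SeminormFamily.withSeminorms_iff_uniformSpace_eq_iInf (r 𝕜 A)).2 rfl

theorem t2Space : T2Space (Ell1Prod 𝕜 A) := by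
  have h1 : T1Space (Ell1Prod 𝕜 A) := by
    refine withSeminorms_r.T1_of_separating fun a ha => ?_
    by_contra! h
    refine ha (ext_coord fun n => ?_)
    by_contra hn
    have := t2 (𝕜 := 𝕜) (A := A n)
    obtain ⟨ℓ, hℓ⟩ := (withSeminorms (𝕜 := 𝕜) (A := A n)).separating_of_T1 _ hn
    exact hℓ (le_antisymm ((seminorm_coord_le ℓ n a).trans (h ℓ).le) (apply_nonneg _ _))
  infer_instance

theorem completeSpace : CompleteSpace (Ell1Prod 𝕜 A) := by
  have : (uniformity (Ell1Prod 𝕜 A)).IsCountablyGenerated := by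
    have := withSeminorms_r (𝕜 := 𝕜) (A := A).firstCountableTopology
    exact IsUniformAddGroup.uniformity_countably_generated
  refine UniformSpace.complete_of_cauchySeq_tendsto fun u hu => ?_
  have hc : ∀ ℓ : ℕ, ∀ ε > 0, ∃ N, ∀ m ≥ N, ∀ k ≥ N, r 𝕜 A ℓ (u m - u k) < ε := by
    intro ℓ ε hε
    have hU : {y | r 𝕜 A ℓ y < ε} ∈ 𝓝 (0 : Ell1Prod 𝕜 A) :=
      (isOpen_lt (withSeminorms_r.continuous_seminorm ℓ) continuous_const).mem_nhds (by simpa)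
    have hV : {z : Ell1Prod 𝕜 A × Ell1Prod 𝕜 A | r 𝕜 A ℓ (z.2 - z.1) < ε} ∈
        uniformity (Ell1Prod 𝕜 A) := by
      rw [uniformity_eq_comap_nhds_zero]
      exact preimage_mem_comap hU
    obtain ⟨N, hN⟩ := cauchySeq_iff.1 hu _ hV
    exact ⟨N, fun m hm k hk => hN k hk m hm⟩
  have hcoord : ∀ n, Continuous (coord n : Ell1Prod 𝕜 A →ₗ[𝕜] A n) := by
    intro n
    refine WithSeminorms.continuous_of_isBounded withSeminorms_r
      (withSeminorms (𝕜 := 𝕜) (A := A n)) _ fun ℓ => ⟨{ℓ}, 1, fun a => ?_⟩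
    simpa using seminorm_coord_le ℓ n a
  have hlim : ∀ n, ∃ x, Tendsto (fun m => coord n (u m)) atTop (𝓝 x) := by
    intro n
    have := complete (𝕜 := 𝕜) (A := A n)
    exact cauchySeq_tendsto_of_complete
      (hu.map (uniformContinuous_addMonoidHom_of_continuous (hcoord n)))
  choose x hx using hlim
  have hfin : ∀ ℓ : ℕ, ∀ ε > 0, ∃ N, ∀ m ≥ N, ∀ s : Finset ℕ,
      ∑ n ∈ s, seminorm (𝕜 := 𝕜) ℓ (coord n (u m) - x n) ≤ ε := by
    intro ℓ ε hε
    obtain ⟨N, hN⟩ := hc ℓ ε hε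
    refine ⟨N, fun m hm s => ?_⟩
    have ht : Tendsto (fun k => ∑ n ∈ s, seminorm (𝕜 := 𝕜) ℓ (coord n (u m) - coord n (u k)))
        atTop (𝓝 (∑ n ∈ s, seminorm (𝕜 := 𝕜) ℓ (coord n (u m) - x n))) :=
      tendsto_finsetSum _ fun n _ =>
        (((withSeminorms (𝕜 := 𝕜) (A := A n)).continuous_seminorm ℓ).tendsto _).comp
          ((hx n).const_sub _)
    refine le_of_tendsto ht ((eventually_ge_atTop N).mono fun k hk => ?_)
    exact ((summable ℓ (u m - u k)).sum_le_tsum s fun _ _ => apply_nonneg _ _).trans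
      (hN m hm k hk).le
  have hmem : x ∈ ell1Subalgebra 𝕜 A := by
    intro ℓ
    obtain ⟨N, hN⟩ := hfin ℓ 1 one_pos
    have hs : Summable fun n => seminorm (𝕜 := 𝕜) ℓ (coord n (u N) - x n) :=
      summable_of_sum_le (fun _ => apply_nonneg _ _) (hN N le_rfl)
    refine Summable.of_nonneg_of_le (fun _ => apply_nonneg _ _) (fun n => ?_)
      ((summable ℓ (u N)).add hs)
    have h := map_sub_le_add (seminorm (𝕜 := 𝕜) (A := A n) ℓ) (coord n (u N))
      (coord n (u N) - x n)
    rwa [sub_sub_cancel] at h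
  obtain ⟨y, hy⟩ : ∃ y : Ell1Prod 𝕜 A, ∀ n, coord n y = x n := ⟨⟨x, hmem⟩, fun _ => rfl⟩
  refine ⟨y, ?_⟩
  rw [(withSeminorms_r (𝕜 := 𝕜) (A := A)).tendsto_nhds_atTop]
  intro ℓ ε hε
  obtain ⟨N, hN⟩ := hfin ℓ (ε / 2) (half_pos hε)
  refine ⟨N, fun m hm => lt_of_le_of_lt ?_ (half_lt_self hε)⟩
  rw [r_apply]
  refine Real.tsum_le_of_sum_le (fun _ => apply_nonneg _ _) fun s => ?_
  simpa only [map_sub, hy] using hN m hm s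

end Ell1Prod

noncomputable instance : FrechetAlgebra 𝕜 (Ell1Prod 𝕜 A) where
  seminorm := Ell1Prod.r 𝕜 A
  withSeminorms := Ell1Prod.withSeminorms_r
  monotone ℓ k h a := (Ell1Prod.summable ℓ a).tsum_le_tsum
    (fun n => monotone (𝕜 := 𝕜) (A := A n) h _) (Ell1Prod.summable k a)
  mul_le ℓ a b := by
    rw [Ell1Prod.r_apply ℓ a, ← tsum_mul_right]
    refine (Ell1Prod.summable ℓ (a * b)).tsum_le_tsum (fun n => ?_)
      ((Ell1Prod.summable ℓ a).mul_right _)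
    exact (mul_le ℓ _ _).trans (mul_le_mul_of_nonneg_left
      (Ell1Prod.seminorm_coord_le ℓ n b) (apply_nonneg _ _))
  t2 := Ell1Prod.t2Space
  complete := Ell1Prod.completeSpace

end Ell1

end FrechetAlgebra

/-!
Write `B` for the `ℓ¹`-product, `ι n : A n → B` and `π n : B → A n` for the canonical inclusion and
projection, and `e n = ι n ∘ π n`.

Regularity passes from `B` to `A n` because `A n` is a retract of `B` and the bitranspose of a
continuous homomorphism respects both Arens products (`firstArens_bitranspose`,
`secondArens_bitranspose`).

For the converse it has to be shown that `(F □ G) f = ∑ n, (F n □ G n) (f ∘ ι n)`, where `F n` and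
`G n` are the images of `F` and `G` in the bidual of `A n`, and likewise for `◇`. Every `F` in the
bidual is continuous for the strong topology, so the first identity follows once the series
`∑ n, (G · f) ∘ e n` converges to `G · f` uniformly on bounded sets. An arbitrary functional on `B`
is not such a strong sum of its components; that `G · f` is one rests on two facts.

* If `a n` runs through a bounded subset of `B`, then the functionals `f · e n (a n)` live on
  different coordinates and are dominated there by a common multiple of one seminorm `p_ℓ`. Hence
  all sums `∑ n ∈ S, c n • (f · e n (a n))` with `‖c n‖ ≤ 1` lie in a single equicontinuous set, on
  which `G` is bounded. Choosing the phases `c n` well gives `∑ n, ‖G (f · e n (a n))‖ < ∞`, which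
  says that `∑ n, ‖(G · f) (e n (a n))‖ < ∞` (`summable_apply_of_blockwise_bound`).
* Letting `a n` almost maximize `‖(G · f) (e n a)‖` over a given bounded set, one obtains a summable
  majorant which is uniform on this set (`tendsto_sum_comp_block`).
-/

namespace FrechetAlgebra

/-! ### Continuous functionals and equicontinuous sets -/

section Arens

variable {𝕜 A B : Type*} [RCLike 𝕜]
  [NonUnitalRing A] [Module 𝕜 A] [IsScalarTower 𝕜 A A] [SMulCommClass 𝕜 A A] [UniformSpace A]
  [IsUniformAddGroup A] [FrechetAlgebra 𝕜 A]
  [NonUnitalRing B] [Module 𝕜 B] [IsScalarTower 𝕜 B B] [SMulCommClass 𝕜 B B] [UniformSpace B]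
  [IsUniformAddGroup B] [FrechetAlgebra 𝕜 B]

/-- Since the seminorms increase, a continuous functional is dominated by a single one. -/
theorem exists_norm_le_seminorm (f : StrongDual 𝕜 A) :
    ∃ (ℓ : ℕ) (C : ℝ), 0 ≤ C ∧ ∀ a, ‖f a‖ ≤ C * seminorm (𝕜 := 𝕜) ℓ a := by
  obtain ⟨s, C, -, h⟩ := Seminorm.bound_of_continuous (withSeminorms (𝕜 := 𝕜) (A := A))
    ((normSeminorm 𝕜 𝕜).comp f.toLinearMap) (continuous_norm.comp f.continuous)
  have hs : s.sup (seminorm (𝕜 := 𝕜) (A := A)) ≤ seminorm (s.sup id) :=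
    Finset.sup_le fun i hi => monotone (Finset.le_sup (f := id) hi)
  exact ⟨s.sup id, C, C.2, fun a => (h a).trans (mul_le_mul_of_nonneg_left (hs a) C.2)⟩

/-- An element of the bidual is bounded on equicontinuous sets of functionals. -/
theorem exists_norm_apply_le_of_equicontinuous (G : StrongDual 𝕜 (StrongDual 𝕜 A)) (ℓ : ℕ) (C : ℝ) :
    ∃ K : ℝ, ∀ h : StrongDual 𝕜 A, (∀ b, ‖h b‖ ≤ C * seminorm (𝕜 := 𝕜) ℓ b) → ‖G h‖ ≤ K := by
  have hG : G ⁻¹' Metric.ball 0 1 ∈ 𝓝 (0 : StrongDual 𝕜 A) :=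
    G.continuous.continuousAt.preimage_mem_nhds (by simpa using Metric.ball_mem_nhds 0 one_pos)
  obtain ⟨⟨N, δ⟩, ⟨hN, hδ⟩, hNδ⟩ := (ContinuousLinearMap.hasBasis_nhds_zero_of_basis
    (σ := RingHom.id 𝕜) (E := A) (F := 𝕜) Metric.nhds_basis_ball).mem_iff.1 hG
  obtain ⟨r, hr, hNr⟩ :=
    ((withSeminorms (𝕜 := 𝕜) (A := A)).isVonNBounded_iff_seminorm_bounded).1 hN ℓ
  -- `t` is small enough for `t • h` to lie in the neighbourhood of `0` given by `N` and `δ`.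
  obtain ⟨t, ht, htδ⟩ : ∃ t : ℝ, 0 < t ∧ t * (|C| * r) < δ := by
    refine ⟨δ / (|C| * r + 1), by positivity, ?_⟩
    rw [div_mul_eq_mul_div, div_lt_iff₀ (by positivity)]
    nlinarith
  refine ⟨t⁻¹, fun h hh => ?_⟩
  have hmem : (t : 𝕜) • h ∈ G ⁻¹' Metric.ball 0 1 := by
    refine hNδ fun b hb => ?_
    have h1 : ‖h b‖ ≤ |C| * r := (hh b).trans <| mul_le_mul (le_abs_self C) (hNr b hb).le
      (apply_nonneg _ _) (abs_nonneg C)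
    have h2 : ‖((t : 𝕜) • h) b‖ = t * ‖h b‖ := by
      rw [smul_apply, norm_smul, RCLike.norm_ofReal, abs_of_pos ht]
    rw [mem_ball_zero_iff, h2]
    exact (mul_le_mul_of_nonneg_left h1 ht.le).trans_lt htδ
  rw [Set.mem_preimage, mem_ball_zero_iff, map_smul, norm_smul, RCLike.norm_ofReal,
    abs_of_pos ht] at hmem
  rw [← one_div, le_div_iff₀ ht, mul_comm]
  exact hmem.le

/-! ### Functoriality of the Arens products -/

/-- The bitranspose `φ** F = F ∘ φ*` of a continuous linear map `φ`. -/
def bitranspose (φ : A →L[𝕜] B) (F : StrongDual 𝕜 (StrongDual 𝕜 A)) :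
    StrongDual 𝕜 (StrongDual 𝕜 B) :=
  F.comp (ContinuousLinearMap.precomp 𝕜 φ)

theorem bitranspose_apply (φ : A →L[𝕜] B) (F : StrongDual 𝕜 (StrongDual 𝕜 A))
    (f : StrongDual 𝕜 B) : bitranspose φ F f = F (f.comp φ) := rfl

theorem bidualSMulLeft_bitranspose_comp {φ : A →L[𝕜] B} (hφ : ∀ a b, φ (a * b) = φ a * φ b)
    (G : StrongDual 𝕜 (StrongDual 𝕜 A)) (f : StrongDual 𝕜 B) :
    (bidualSMulLeft (bitranspose φ G) f).comp φ = bidualSMulLeft G (f.comp φ) := by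
  ext a
  rw [ContinuousLinearMap.comp_apply, bidualSMulLeft_apply, bidualSMulLeft_apply, bitranspose_apply]
  congr 1
  ext b
  simp [hφ]

theorem bidualSMulRight_bitranspose_comp {φ : A →L[𝕜] B} (hφ : ∀ a b, φ (a * b) = φ a * φ b)
    (F : StrongDual 𝕜 (StrongDual 𝕜 A)) (f : StrongDual 𝕜 B) :
    (bidualSMulRight (bitranspose φ F) f).comp φ = bidualSMulRight F (f.comp φ) := by
  ext a
  rw [ContinuousLinearMap.comp_apply, bidualSMulRight_apply, bidualSMulRight_apply,
    bitranspose_apply]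
  congr 1
  ext b
  simp [hφ]

theorem firstArens_bitranspose {φ : A →L[𝕜] B} (hφ : ∀ a b, φ (a * b) = φ a * φ b)
    (F G : StrongDual 𝕜 (StrongDual 𝕜 A)) :
    firstArens (bitranspose φ F) (bitranspose φ G) = bitranspose φ (firstArens F G) := by
  ext f
  exact congrArg F (bidualSMulLeft_bitranspose_comp hφ G f)

theorem secondArens_bitranspose {φ : A →L[𝕜] B} (hφ : ∀ a b, φ (a * b) = φ a * φ b)
    (F G : StrongDual 𝕜 (StrongDual 𝕜 A)) :
    secondArens (bitranspose φ F) (bitranspose φ G) = bitranspose φ (secondArens F G) := by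
  ext f
  exact congrArg G (bidualSMulRight_bitranspose_comp hφ F f)

/-- Arens regularity passes to retracts. -/
theorem IsArensRegular.of_retract (hB : IsArensRegular 𝕜 B) (φ : A →L[𝕜] B) (ψ : B →L[𝕜] A)
    (hφ : ∀ a b, φ (a * b) = φ a * φ b) (h : ∀ a, ψ (φ a) = a) : IsArensRegular 𝕜 A := by
  intro F G
  ext f
  have hf : (f.comp ψ).comp φ = f := by
    ext a
    simp [h]
  have := congrArg (fun H => H (f.comp ψ)) (hB (bitranspose φ F) (bitranspose φ G))
  simpa only [firstArens_bitranspose hφ, secondArens_bitranspose hφ, bitranspose_apply, hf]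
    using this

end Arens

/-! ### Coordinates of the `ℓ¹`-product -/

namespace Ell1Prod

variable {𝕜 : Type*} {A : ℕ → Type*} [RCLike 𝕜] [∀ n, NonUnitalRing (A n)] [∀ n, Module 𝕜 (A n)]
  [∀ n, IsScalarTower 𝕜 (A n) (A n)] [∀ n, SMulCommClass 𝕜 (A n) (A n)]
  [∀ n, UniformSpace (A n)] [∀ n, IsUniformAddGroup (A n)] [∀ n, FrechetAlgebra 𝕜 (A n)]

/-- The `n`-th coordinate, as a continuous linear map. -/
noncomputable def coordL (n : ℕ) : Ell1Prod 𝕜 A →L[𝕜] A n where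
  toLinearMap := coord n
  cont := WithSeminorms.continuous_of_isBounded withSeminorms_r
    (withSeminorms (𝕜 := 𝕜) (A := A n)) _ fun ℓ =>
      ⟨{ℓ}, 1, fun a => by simpa using seminorm_coord_le ℓ n a⟩

theorem hasSum_seminorm_single (ℓ n : ℕ) (x : A n) :
    HasSum (fun m => seminorm (𝕜 := 𝕜) ℓ (Pi.single (M := A) n x m)) (seminorm (𝕜 := 𝕜) ℓ x) := by
  have h := hasSum_single (f := fun m => seminorm (𝕜 := 𝕜) ℓ (Pi.single (M := A) n x m)) n
    fun m hm => by rw [Pi.single_eq_of_ne hm, map_zero]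
  rwa [Pi.single_eq_same] at h

/-- The inclusion of the `n`-th factor, as a linear map. -/
def incl (n : ℕ) : A n →ₗ[𝕜] Ell1Prod 𝕜 A where
  toFun x := ⟨Pi.single n x, fun ℓ => (hasSum_seminorm_single ℓ n x).summable⟩
  map_add' x y := Subtype.ext (Pi.single_add n x y)
  map_smul' c x := Subtype.ext (Pi.single_smul n c x)

theorem r_incl (ℓ n : ℕ) (x : A n) : r 𝕜 A ℓ (incl n x) = seminorm (𝕜 := 𝕜) ℓ x :=
  (hasSum_seminorm_single ℓ n x).tsum_eq

/-- The inclusion of the `n`-th factor, as a continuous linear map. -/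
noncomputable def inclL (n : ℕ) : A n →L[𝕜] Ell1Prod 𝕜 A where
  toLinearMap := incl n
  cont := WithSeminorms.continuous_of_isBounded (withSeminorms (𝕜 := 𝕜) (A := A n))
    withSeminorms_r _ fun ℓ => ⟨{ℓ}, 1, fun x => by simpa using (r_incl ℓ n x).le⟩

theorem inclL_mul (n : ℕ) (x y : A n) :
    inclL (𝕜 := 𝕜) n (x * y) = inclL n x * inclL n y :=
  Subtype.ext (Pi.single_mul n x y)

theorem coordL_mul (n : ℕ) (a b : Ell1Prod 𝕜 A) : coordL n (a * b) = coordL n a * coordL n b := rfl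

theorem coordL_inclL (n : ℕ) (x : A n) : coordL n (inclL (𝕜 := 𝕜) n x) = x :=
  Pi.single_eq_same n x

/-- The projection `e n = ι n ∘ π n` of the `ℓ¹`-product onto its `n`-th factor. -/
noncomputable def block (n : ℕ) : Ell1Prod 𝕜 A →L[𝕜] Ell1Prod 𝕜 A := (inclL n).comp (coordL n)

theorem r_block (ℓ n : ℕ) (a : Ell1Prod 𝕜 A) :
    r 𝕜 A ℓ (block n a) = seminorm (𝕜 := 𝕜) ℓ (coord n a) := r_incl ℓ n _

theorem coord_block (n m : ℕ) (a : Ell1Prod 𝕜 A) :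
    coord m (block n a) = Pi.single (M := A) n (coord n a) m := rfl

theorem block_mul_left (n : ℕ) (a b : Ell1Prod 𝕜 A) : block n a * b = block n (a * b) := by
  refine ext_coord fun m => ?_
  rw [coord_mul, coord_block, coord_block, coord_mul]
  obtain rfl | h := eq_or_ne m n
  · simp
  · simp [Pi.single_eq_of_ne h]

theorem block_mul_right (n : ℕ) (a b : Ell1Prod 𝕜 A) : a * block n b = block n (a * b) := by
  refine ext_coord fun m => ?_
  rw [coord_mul, coord_block, coord_block, coord_mul]
  obtain rfl | h := eq_or_ne m n
  · simp
  · simp [Pi.single_eq_of_ne h]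

theorem coord_sum_block (s : Finset ℕ) (m : ℕ) (a : Ell1Prod 𝕜 A) :
    coord m (∑ n ∈ s, block n a) = if m ∈ s then coord m a else 0 := by
  rw [map_sum]
  simp only [coord_block]
  split_ifs with h
  · rw [Finset.sum_eq_single_of_mem m h fun n _ hn => Pi.single_eq_of_ne hn.symm _,
      Pi.single_eq_same]
  · exact Finset.sum_eq_zero fun n hn => Pi.single_eq_of_ne (ne_of_mem_of_not_mem hn h).symm _

/-- Every element of the `ℓ¹`-product is the sum of its blocks. -/
theorem hasSum_block (a : Ell1Prod 𝕜 A) : HasSum (fun n => block n a) a := by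
  rw [HasSum, SummationFilter.unconditional_filter,
    (withSeminorms_r (𝕜 := 𝕜) (A := A)).tendsto_nhds]
  intro ℓ ε hε
  have h := tendsto_tsum_compl_atTop_zero fun n => seminorm (𝕜 := 𝕜) ℓ (coord n a)
  filter_upwards [h.eventually_lt_const hε] with s hs
  refine lt_of_eq_of_lt ?_ hs
  rw [r_apply]
  refine Eq.trans ?_ (tsum_subtype {n | n ∉ s} fun n => seminorm (𝕜 := 𝕜) ℓ (coord n a)).symm
  refine tsum_congr fun m => ?_
  rw [map_sub, coord_sum_block]
  by_cases hm : m ∈ s <;> simp [hm]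

/-! ### Strong convergence of the block series -/

/-- If the `n`-th functional depends only on the `n`-th coordinate, with a bound uniform in `n`,
then every element of the bidual is absolutely summable along the sequence: the finite sums with
unimodular coefficients are equicontinuous, and the coefficients may be chosen as the phases. -/
theorem summable_apply_of_blockwise_bound (G : StrongDual 𝕜 (StrongDual 𝕜 (Ell1Prod 𝕜 A)))
    (Φ : ℕ → StrongDual 𝕜 (Ell1Prod 𝕜 A)) (ℓ : ℕ) (C : ℝ) (hC : 0 ≤ C)
    (hΦ : ∀ n b, ‖Φ n b‖ ≤ C * seminorm (𝕜 := 𝕜) ℓ (coord n b)) :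
    Summable fun n => ‖G (Φ n)‖ := by
  obtain ⟨K, hK⟩ := exists_norm_apply_le_of_equicontinuous G ℓ C
  have hphase : ∀ n, ∃ c : 𝕜, ‖c‖ = 1 ∧ (‖G (Φ n)‖ : 𝕜) = c * G (Φ n) :=
    fun n => RCLike.exists_norm_eq_mul_self _
  choose c hc hcG using hphase
  refine summable_of_sum_le (c := K) (fun _ => norm_nonneg _) fun s => ?_
  have hb : ∀ b, ‖(∑ n ∈ s, c n • Φ n) b‖ ≤ C * r 𝕜 A ℓ b := fun b => by
    rw [sum_apply]
    calc ‖∑ n ∈ s, (c n • Φ n) b‖ ≤ ∑ n ∈ s, C * seminorm (𝕜 := 𝕜) ℓ (coord n b) :=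
          norm_sum_le_of_le _ fun n _ => by
            rw [smul_apply, norm_smul, hc, one_mul]
            exact hΦ n b
      _ ≤ C * r 𝕜 A ℓ b := by
          rw [← Finset.mul_sum]
          exact mul_le_mul_of_nonneg_left
            ((summable ℓ b).sum_le_tsum s fun _ _ => apply_nonneg _ _) hC
  have hG : G (∑ n ∈ s, c n • Φ n) = ((∑ n ∈ s, ‖G (Φ n)‖ : ℝ) : 𝕜) := by
    rw [map_sum, RCLike.ofReal_sum]
    exact Finset.sum_congr rfl fun n _ => by rw [map_smul, smul_eq_mul, hcG]
  have h := hK _ hb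
  rw [hG, RCLike.norm_ofReal] at h
  exact (le_abs_self _).trans h

/-- A functional which is absolutely summable along the blocks of every bounded sequence is the
strong limit of the sums of its components. -/
theorem tendsto_sum_comp_block (H : StrongDual 𝕜 (Ell1Prod 𝕜 A))
    (hH : ∀ a : ℕ → Ell1Prod 𝕜 A, Bornology.IsVonNBounded 𝕜 (Set.range a) →
      Summable fun n => ‖H (block n (a n))‖) :
    Tendsto (fun N => ∑ n ∈ Finset.range N, H.comp (block n)) atTop (𝓝 H) := by
  rw [← tendsto_sub_nhds_zero_iff,
    (ContinuousLinearMap.hasBasis_nhds_zero_of_basis (σ := RingHom.id 𝕜) (E := Ell1Prod 𝕜 A)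
      (F := 𝕜) Metric.nhds_basis_ball).tendsto_right_iff]
  rintro ⟨M, ε⟩ ⟨hM, hε⟩
  obtain rfl | ⟨a₀, ha₀⟩ := M.eq_empty_or_nonempty
  · simp
  -- Up to a factor `2`, the supremum of `‖H (e n a)‖` over `M` is attained.
  have hmax : ∀ n, ∃ a ∈ M, ∀ b ∈ M, ‖H (block n b)‖ ≤ 2 * ‖H (block n a)‖ := by
    intro n
    obtain ⟨R, hR⟩ := isBounded_iff_forall_norm_le.1 ((NormedSpace.isVonNBounded_iff 𝕜).1
      (hM.image (H.comp (block n))))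
    have hbd : BddAbove ((fun a => ‖H (block n a)‖) '' M) := by
      refine ⟨R, ?_⟩
      rintro _ ⟨a, ha, rfl⟩
      exact hR _ ⟨a, ha, rfl⟩
    by_contra! h
    obtain ⟨b, hb, hlt⟩ := h a₀ ha₀
    have hpos : 0 < sSup ((fun a => ‖H (block n a)‖) '' M) :=
      (lt_of_le_of_lt (by positivity) hlt).trans_le (le_csSup hbd ⟨b, hb, rfl⟩)
    obtain ⟨_, ⟨a, ha, rfl⟩, hsup⟩ := exists_lt_of_lt_csSup
      (Set.image_nonempty.2 ⟨a₀, ha₀⟩) (half_lt_self hpos)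
    obtain ⟨b', hb', hlt'⟩ := h a ha
    have := le_csSup hbd ⟨b', hb', rfl⟩
    dsimp only at hsup this
    linarith
  choose a haM ha using hmax
  have hsum : Summable fun n => 2 * ‖H (block n (a n))‖ :=
    (hH a (hM.subset (Set.range_subset_iff.2 haM))).mul_left 2
  filter_upwards [(tendsto_sum_nat_add fun n => 2 * ‖H (block n (a n))‖).eventually_lt_const hε]
    with N hN b hb
  have hHb : HasSum (fun n => H (block n b)) (H b) := (hasSum_block b).mapL H
  have htail := (hasSum_nat_add_iff' N).2 hHb
  rw [mem_ball_zero_iff, sub_apply, sum_apply, norm_sub_rev]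
  refine lt_of_le_of_lt ?_ hN
  exact htail.norm_le_of_bounded ((summable_nat_add_iff N).2 hsum).hasSum fun n => ha _ b hb

/-- For `a` in a bounded set, the functionals `f · e n a` and `e n a · f` satisfy a common bound of
the kind required in `summable_apply_of_blockwise_bound`. -/
theorem exists_norm_apply_block_mul_le (f : StrongDual 𝕜 (Ell1Prod 𝕜 A)) {M : Set (Ell1Prod 𝕜 A)}
    (hM : Bornology.IsVonNBounded 𝕜 M) :
    ∃ (ℓ : ℕ) (C : ℝ), 0 ≤ C ∧ ∀ a ∈ M, ∀ n b,
      ‖f (block n (a * b))‖ ≤ C * seminorm (𝕜 := 𝕜) ℓ (coord n b) ∧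
      ‖f (block n (b * a))‖ ≤ C * seminorm (𝕜 := 𝕜) ℓ (coord n b) := by
  obtain ⟨ℓ, C, hC, hf⟩ := exists_norm_le_seminorm f
  obtain ⟨K, hK, hMK⟩ :=
    ((withSeminorms_r (𝕜 := 𝕜) (A := A)).isVonNBounded_iff_seminorm_bounded).1 hM ℓ
  refine ⟨ℓ, C * K, by positivity, fun a ha n b => ?_⟩
  have hfn : ∀ x, ‖f (block n x)‖ ≤ C * seminorm (𝕜 := 𝕜) ℓ (coord n x) := fun x =>
    (hf _).trans_eq (congrArg (C * ·) (r_block ℓ n x))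
  have haK : seminorm (𝕜 := 𝕜) ℓ (coord n a) ≤ K := (seminorm_coord_le ℓ n a).trans (hMK a ha).le
  constructor <;> refine (hfn _).trans ?_ <;> rw [mul_assoc, coord_mul] <;>
    refine mul_le_mul_of_nonneg_left ((mul_le ℓ _ _).trans ?_) hC
  · exact mul_le_mul_of_nonneg_right haK (apply_nonneg _ _)
  · rw [mul_comm]
    exact mul_le_mul_of_nonneg_right haK (apply_nonneg _ _)

theorem tendsto_sum_bidualSMulLeft_comp_block (G : StrongDual 𝕜 (StrongDual 𝕜 (Ell1Prod 𝕜 A)))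
    (f : StrongDual 𝕜 (Ell1Prod 𝕜 A)) :
    Tendsto (fun N => ∑ n ∈ Finset.range N, (bidualSMulLeft G f).comp (block n)) atTop
      (𝓝 (bidualSMulLeft G f)) := by
  refine tendsto_sum_comp_block _ fun a ha => ?_
  obtain ⟨ℓ, C, hC, h⟩ := exists_norm_apply_block_mul_le f ha
  refine summable_apply_of_blockwise_bound G (fun n => dualSMulRight f (block n (a n))) ℓ C hC
    fun n b => ?_
  rw [dualSMulRight_apply, block_mul_left]
  exact (h _ ⟨n, rfl⟩ n b).1

theorem tendsto_sum_bidualSMulRight_comp_block (F : StrongDual 𝕜 (StrongDual 𝕜 (Ell1Prod 𝕜 A)))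
    (f : StrongDual 𝕜 (Ell1Prod 𝕜 A)) :
    Tendsto (fun N => ∑ n ∈ Finset.range N, (bidualSMulRight F f).comp (block n)) atTop
      (𝓝 (bidualSMulRight F f)) := by
  refine tendsto_sum_comp_block _ fun a ha => ?_
  obtain ⟨ℓ, C, hC, h⟩ := exists_norm_apply_block_mul_le f ha
  refine summable_apply_of_blockwise_bound F (fun n => dualSMulLeft (block n (a n)) f) ℓ C hC
    fun n b => ?_
  rw [dualSMulLeft_apply, block_mul_right]
  exact (h _ ⟨n, rfl⟩ n b).2

/-! ### Arens products on the `ℓ¹`-product -/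

theorem bidualSMulLeft_comp_block (G : StrongDual 𝕜 (StrongDual 𝕜 (Ell1Prod 𝕜 A)))
    (f : StrongDual 𝕜 (Ell1Prod 𝕜 A)) (n : ℕ) :
    (bidualSMulLeft G f).comp (block n) =
      (bidualSMulLeft (bitranspose (coordL n) G) (f.comp (inclL n))).comp (coordL n) := by
  rw [bidualSMulLeft_bitranspose_comp (coordL_mul n)]
  ext a
  refine congrArg G ?_
  ext b
  exact congrArg f (block_mul_left n a b)

theorem bidualSMulRight_comp_block (F : StrongDual 𝕜 (StrongDual 𝕜 (Ell1Prod 𝕜 A)))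
    (f : StrongDual 𝕜 (Ell1Prod 𝕜 A)) (n : ℕ) :
    (bidualSMulRight F f).comp (block n) =
      (bidualSMulRight (bitranspose (coordL n) F) (f.comp (inclL n))).comp (coordL n) := by
  rw [bidualSMulRight_bitranspose_comp (coordL_mul n)]
  ext a
  refine congrArg F ?_
  ext b
  exact congrArg f (block_mul_right n b a)

/-- The first Arens product on the `ℓ¹`-product is computed coordinatewise. -/
theorem tendsto_sum_firstArens (F G : StrongDual 𝕜 (StrongDual 𝕜 (Ell1Prod 𝕜 A)))
    (f : StrongDual 𝕜 (Ell1Prod 𝕜 A)) :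
    Tendsto (fun N => ∑ n ∈ Finset.range N,
        firstArens (bitranspose (coordL n) F) (bitranspose (coordL n) G) (f.comp (inclL n)))
      atTop (𝓝 (firstArens F G f)) := by
  have h := (F.continuous.tendsto _).comp (tendsto_sum_bidualSMulLeft_comp_block G f)
  refine h.congr fun N => ?_
  rw [Function.comp_apply, map_sum]
  exact Finset.sum_congr rfl fun n _ => congrArg F (bidualSMulLeft_comp_block G f n)

/-- The second Arens product on the `ℓ¹`-product is computed coordinatewise. -/
theorem tendsto_sum_secondArens (F G : StrongDual 𝕜 (StrongDual 𝕜 (Ell1Prod 𝕜 A)))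
    (f : StrongDual 𝕜 (Ell1Prod 𝕜 A)) :
    Tendsto (fun N => ∑ n ∈ Finset.range N,
        secondArens (bitranspose (coordL n) F) (bitranspose (coordL n) G) (f.comp (inclL n)))
      atTop (𝓝 (secondArens F G f)) := by
  have h := (G.continuous.tendsto _).comp (tendsto_sum_bidualSMulRight_comp_block F f)
  refine h.congr fun N => ?_
  rw [Function.comp_apply, map_sum]
  exact Finset.sum_congr rfl fun n _ => congrArg G (bidualSMulRight_comp_block F f n)

end Ell1Prod

end FrechetAlgebra

theorem mainTheorem1 {𝕜 : Type*} [RCLike 𝕜] (A : ℕ → Type*) [∀ n, NonUnitalRing (A n)]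
    [∀ n, Module 𝕜 (A n)] [∀ n, IsScalarTower 𝕜 (A n) (A n)] [∀ n, SMulCommClass 𝕜 (A n) (A n)]
    [∀ n, UniformSpace (A n)] [∀ n, IsUniformAddGroup (A n)] [∀ n, FrechetAlgebra 𝕜 (A n)] :
    FrechetAlgebra.IsArensRegular 𝕜 (FrechetAlgebra.Ell1Prod 𝕜 A) ↔
      ∀ n, FrechetAlgebra.IsArensRegular 𝕜 (A n) := by
  refine ⟨fun h n => h.of_retract (FrechetAlgebra.Ell1Prod.inclL n)
    (FrechetAlgebra.Ell1Prod.coordL n) (FrechetAlgebra.Ell1Prod.inclL_mul n)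
    (FrechetAlgebra.Ell1Prod.coordL_inclL n), fun h F G => ?_⟩
  ext f
  have h1 := FrechetAlgebra.Ell1Prod.tendsto_sum_firstArens F G f
  simp only [h _ _ _] at h1
  exact tendsto_nhds_unique h1 (FrechetAlgebra.Ell1Prod.tendsto_sum_secondArens F G f)
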